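/- All Banach spaces are real. For a Banach space $X$, $\mathrm{Lip}_0(X,Y)$ is the space of Lipschitz maps $f:X\to Y$ with $f(0)=0$, normed by the best Lipschitz constant $\|f\|_{\mathrm{Lip}}$; $\mathrm{Lip}_0(X)=\mathrm{Lip}_0(X,\mathbb R)$; the Lipschitz-free space $\mathfrak F(X)$ is the closed linear span in $\mathrm{Lip}_0(X)^*$ of the evaluations $\delta_x$, $x\in X$; each $f\in \mathrm{Lip}_0(X,Y)$ has a unique linearization $L_f\in\mathcal L(\mathfrak F(X),Y)$ with $L_f\delta_x=f(x)$; and $\beta_X=L_{\mathrm{Id}_X}:\mathfrak F(X)\to X$, so that $x^*(\beta_X\mu)=\langle x^*,\mu\rangle$ for $x^*\in X^*\subseteq \mathrm{Lip}_0(X)$. For a closed subspace $M$ of $X$, $\mathfrak F(M)$ is regarded as a closed subspace of $\mathfrak F(X)$ through the canonical isometric embedding $\delta_m\mapsto\delta_m$. A closed subspace $N$ of a Banach space $E$ is an ideal in $E$ if there is a bounded linear operator $\sigma:N^*\to E^*$ with $\sigma(\varphi)|_N=\varphi$ and $\|\sigma(\varphi)\|=\|\varphi\|$ for all $\varphi\in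 N^*$. Let $\mathcal A$ be an operator ideal, $\mathcal A^d(X,Y)=\{T\in\mathcal L(X,Y):T^*\in\mathcal A(Y^*,X^*)\}$, $\mathcal A^\lambda(X,Y)=\{T\in\mathcal A(X,Y):\|T\|\le\lambda\}$ and $\mathrm{Lip}_{\mathcal A}^\lambda(X,Y)=\{f\in\mathrm{Lip}_0(X,Y): L_f\in\mathcal A(\mathfrak F(X),Y),\ \|f\|_{\mathrm{Lip}}\le\lambda\}$. A Banach space $X$ has the $\mathcal A$-BAP (respectively the $\mathrm{Lip}$-$\mathcal A$-BAP) if for some $\lambda\ge1$ the identity of $X$ is in the closure of $\mathcal A^\lambda(X,X)$ (respectively of $\mathrm{Lip}_{\mathcal A}^\lambda(X,X)$) for the topology of uniform convergence on compact sets. **Theorem.** Let $X$ be a Banach space and $M$ a closed subspace of $X$ such that $\mathfrak F(M)$ is an ideal in $\mathfrak F(X)$. Let $\mathcal A$ be an operator ideal with $\mathcal A=\mathcal A^d$. If $M$ has the $\mathrm{Lip}$-$\mathcal A$-BAP and $\mathfrak F(X)/\mathfrak F(M)$ has the $\mathcal A$-BAP, then there is $\lambda\ge 1$ such that $$\beta_X^*\in\overline{\mathcal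 A^\lambda(X^*,\mathfrak F(X)^*)}^{\,w^*},$$ where $w^*$ is the weak-star topology of $\mathcal L(X^*,\mathfrak F(X)^*)=(X^*\widehat\otimes_\pi\mathfrak F(X))^*$, the dual of the completed projective tensor product. -/

import Mathlib

universe u v w

open Topology
open scoped NNReal TensorProduct

set_option linter.unusedSectionVars false

noncomputable section

namespace LipFreeAP

/-! ### Spaces of Lipschitz maps vanishing at the origin -/

section Lip

variable (X : Type u) (Y : Type v) [NormedAddCommGroup X] [NormedSpace ℝ X]
  [NormedAddCommGroup Y] [NormedSpace ℝ Y]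

/-- The vector space of Lipschitz maps `f : X → Y` with `f 0 = 0`. -/
def lipZeroSubmodule : Submodule ℝ (X → Y) where
  carrier := {f | f 0 = 0 ∧ ∃ K : ℝ≥0, LipschitzWith K f}
  zero_mem' := ⟨rfl, 0, LipschitzWith.const 0⟩
  add_mem' := by
    rintro f g ⟨hf, K, hK⟩ ⟨hg, L, hL⟩
    exact ⟨by simp [hf, hg], K + L, hK.add hL⟩
  smul_mem' := by
    rintro c f ⟨hf, K, hK⟩
    exact ⟨by simp [hf], ‖c‖₊ * K, (lipschitzWith_smul c).comp hK⟩

/-- `Lip₀(X, Y)`, the space of Lipschitz maps `f : X → Y` with `f 0 = 0`;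
it carries the Lipschitz norm (below). -/
def LipZero : Type (max u v) := lipZeroSubmodule X Y

/-- The additive group structure; superseded by the normed group structure below. -/
abbrev LipZero.group : AddCommGroup (LipZero X Y) :=
  inferInstanceAs (AddCommGroup (lipZeroSubmodule X Y))

/-- The vector space structure; superseded by the normed space structure below. -/
abbrev LipZero.module :
    letI := LipZero.group X Y
    Module ℝ (LipZero X Y) :=
  inferInstanceAs (Module ℝ (lipZeroSubmodule X Y))

variable {X Y}

namespace LipZero

section Core

attribute [local instance] LipZero.group LipZero.module

instance : FunLike (LipZero X Y) X Y where
  coe f := f.1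
  coe_injective _ _ h := Subtype.ext h

@[ext] theorem ext {f g : LipZero X Y} (h : ∀ x, f x = g x) : f = g := DFunLike.ext _ _ h

@[simp] theorem coe_mk (f : X → Y) (hf : f ∈ lipZeroSubmodule X Y) (x : X) :
    (show LipZero X Y from ⟨f, hf⟩) x = f x := rfl
@[simp] theorem map_zero (f : LipZero X Y) : f 0 = 0 := f.2.1

theorem exists_lipschitzWith (f : LipZero X Y) : ∃ K : ℝ≥0, LipschitzWith K f := f.2.2

/-- The Lipschitz norm: the supremum of all slopes `‖f x - f y‖ / ‖x - y‖`
(the pairs with `x = y` contribute `0 / 0 = 0`). -/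
instance : Norm (LipZero X Y) :=
  ⟨fun f => ⨆ p : X × X, ‖f p.1 - f p.2‖ / ‖p.1 - p.2‖⟩

theorem norm_def (f : LipZero X Y) : ‖f‖ = ⨆ p : X × X, ‖f p.1 - f p.2‖ / ‖p.1 - p.2‖ := rfl

theorem bddAbove_slope (f : LipZero X Y) :
    BddAbove (Set.range fun p : X × X => ‖f p.1 - f p.2‖ / ‖p.1 - p.2‖) := by
  obtain ⟨K, hK⟩ := f.exists_lipschitzWith
  refine ⟨K, ?_⟩
  rintro _ ⟨p, rfl⟩
  exact div_le_of_le_mul₀ (norm_nonneg _) K.2 (by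
    simpa only [dist_eq_norm] using! hK.dist_le_mul p.1 p.2)

theorem norm_sub_le (f : LipZero X Y) (x y : X) : ‖f x - f y‖ ≤ ‖f‖ * ‖x - y‖ := by
  rcases eq_or_ne x y with rfl | h
  · simp
  · have := le_ciSup f.bddAbove_slope (x, y)
    exact (div_le_iff₀ (norm_pos_iff.2 (sub_ne_zero.2 h))).1 this

theorem norm_apply_le (f : LipZero X Y) (x : X) : ‖f x‖ ≤ ‖f‖ * ‖x‖ := by
  simpa using f.norm_sub_le x 0

theorem norm_le_of (f : LipZero X Y) {K : ℝ} (hK : 0 ≤ K)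
    (h : ∀ x y, ‖f x - f y‖ ≤ K * ‖x - y‖) : ‖f‖ ≤ K :=
  ciSup_le fun p => div_le_of_le_mul₀ (norm_nonneg _) hK (h p.1 p.2)

theorem norm_nonneg' (f : LipZero X Y) : 0 ≤ ‖f‖ :=
  Real.iSup_nonneg fun _ => by positivity

theorem core : NormedSpace.Core ℝ (LipZero X Y) where
  norm_nonneg := norm_nonneg'
  norm_smul c f := by
    rw [norm_def, norm_def, Real.mul_iSup_of_nonneg (norm_nonneg c)]
    congr 1; ext p
    change ‖c • f p.1 - c • f p.2‖ / _ = _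
    rw [← smul_sub, norm_smul, mul_div_assoc]
  norm_triangle f g := by
    refine norm_le_of _ (add_nonneg (norm_nonneg' f) (norm_nonneg' g)) fun x y => ?_
    have h : (f + g) x - (f + g) y = (f x - f y) + (g x - g y) := by
      change (f x + g x) - (f y + g y) = _
      abel
    rw [h, add_mul]
    exact (norm_add_le _ _).trans (add_le_add (f.norm_sub_le x y) (g.norm_sub_le x y))
  norm_eq_zero_iff f := by
    constructor
    · intro h
      ext x
      have := f.norm_apply_le x
      rw [h, zero_mul] at this
      simpa using! norm_le_zero_iff.1 this
    · rintro rfl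
      have h0 : ∀ x : X, (0 : LipZero X Y) x = 0 := fun _ => rfl
      simp [norm_def, h0]

instance normedGroup : NormedAddCommGroup (LipZero X Y) :=
  NormedAddCommGroup.ofCore (core (X := X) (Y := Y))

instance normedSpace : NormedSpace ℝ (LipZero X Y) :=
  NormedSpace.ofCore (core (X := X) (Y := Y))

end Core

@[simp] theorem add_apply (f g : LipZero X Y) (x : X) : (f + g) x = f x + g x := rfl
@[simp] theorem smul_apply (c : ℝ) (f : LipZero X Y) (x : X) : (c • f) x = c • f x := rfl
@[simp] theorem zero_apply (x : X) : (0 : LipZero X Y) x = 0 := rfl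
@[simp] theorem sub_apply (f g : LipZero X Y) (x : X) : (f - g) x = f x - g x := rfl

theorem continuous (f : LipZero X Y) : Continuous f :=
  f.exists_lipschitzWith.choose_spec.continuous

/-- A map in `Lip₀(X, Y)` as an element of `C(X, Y)`, which carries the compact-open topology. -/
def toContinuousMap (f : LipZero X Y) : C(X, Y) := ⟨f, f.continuous⟩

/-- Maps with a given Lipschitz bound, as elements of `Lip₀(X, Y)`. -/
def ofBound (f : X → Y) (h0 : f 0 = 0) (K : ℝ) (h : ∀ x y, ‖f x - f y‖ ≤ K * ‖x - y‖) :
    LipZero X Y :=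
  ⟨f, h0, K.toNNReal, LipschitzWith.of_dist_le' (by simpa only [dist_eq_norm] using h)⟩

@[simp] theorem ofBound_apply (f : X → Y) (h0 : f 0 = 0) (K : ℝ)
    (h : ∀ x y, ‖f x - f y‖ ≤ K * ‖x - y‖) (x : X) : ofBound f h0 K h x = f x := rfl

variable (X) in
/-- The identity of `X` as an element of `Lip₀(X, X)`. -/
def id : LipZero X X := ofBound (fun x => x) rfl 1 (by simp)

@[simp] theorem id_apply (x : X) : id X x = x := rfl

/-- The Lipschitz transpose `Y* → Lip₀(X)`, `φ ↦ φ ∘ f`, of `f ∈ Lip₀(X, Y)`. -/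
def transpose (f : LipZero X Y) : StrongDual ℝ Y →L[ℝ] LipZero X ℝ :=
  LinearMap.mkContinuous
    { toFun := fun φ => ofBound (fun x => φ (f x)) (by simp) (‖φ‖ * ‖f‖) (fun x y => by
        rw [← _root_.map_sub, mul_assoc]
        exact (φ.le_opNorm _).trans
          (mul_le_mul_of_nonneg_left (f.norm_sub_le x y) (norm_nonneg φ)))
      map_add' := fun _ _ => rfl
      map_smul' := fun _ _ => rfl }
    ‖f‖ (fun φ => by
      refine norm_le_of _ (by positivity) fun x y => ?_
      change ‖φ (f x) - φ (f y)‖ ≤ _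
      rw [← _root_.map_sub, mul_comm ‖f‖, mul_assoc]
      exact (φ.le_opNorm _).trans
        (mul_le_mul_of_nonneg_left (f.norm_sub_le x y) (norm_nonneg φ)))

@[simp] theorem transpose_apply (f : LipZero X Y) (φ : StrongDual ℝ Y) (x : X) :
    f.transpose φ x = φ (f x) := rfl

end LipZero

end Lip

/-! ### The Lipschitz-free space -/

section Free

variable (X : Type u) [NormedAddCommGroup X] [NormedSpace ℝ X]

variable {X} in
/-- The evaluation functional `δ_x ∈ Lip₀(X)*`. -/
def evalFunctional (x : X) : StrongDual ℝ (LipZero X ℝ) :=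
  LinearMap.mkContinuous
    { toFun := fun f => f x
      map_add' := fun _ _ => rfl
      map_smul' := fun _ _ => rfl }
    ‖x‖ (fun f => by simpa [mul_comm] using! f.norm_apply_le x)

@[simp] theorem evalFunctional_apply {X : Type u} [NormedAddCommGroup X] [NormedSpace ℝ X]
    (x : X) (f : LipZero X ℝ) : evalFunctional x f = f x := rfl

/-- The Lipschitz-free space `𝔉(X)`: the closed linear span of the evaluation functionals
in `Lip₀(X)*`. -/
def freeSpace : Submodule ℝ (StrongDual ℝ (LipZero X ℝ)) :=
  (Submodule.span ℝ (Set.range (evalFunctional (X := X)))).topologicalClosure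

/-- The Lipschitz-free space as a Banach space. -/
def Free : Type u := freeSpace X

instance : NormedAddCommGroup (Free X) := inferInstanceAs (NormedAddCommGroup (freeSpace X))
instance : NormedSpace ℝ (Free X) := inferInstanceAs (NormedSpace ℝ (freeSpace X))
instance : CompleteSpace (Free X) :=
  have h : IsClosed (freeSpace X : Set (StrongDual ℝ (LipZero X ℝ))) :=
    Submodule.isClosed_topologicalClosure _
  h.completeSpace_coe

variable {X}

/-- The inclusion of `𝔉(X)` into `Lip₀(X)*`. -/
def Free.toDual : Free X →L[ℝ] StrongDual ℝ (LipZero X ℝ) := (freeSpace X).subtypeL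

theorem Free.toDual_mem (μ : Free X) : Free.toDual μ ∈ freeSpace X := μ.2

theorem Free.toDual_injective : Function.Injective (Free.toDual (X := X)) := Subtype.val_injective

@[simp] theorem Free.norm_toDual (μ : Free X) : ‖Free.toDual μ‖ = ‖μ‖ := rfl

/-- The map `δ_X : X → 𝔉(X)`. -/
def delta (x : X) : Free X :=
  ⟨evalFunctional x, Submodule.le_topologicalClosure _ (Submodule.subset_span ⟨x, rfl⟩)⟩

@[simp] theorem toDual_delta (x : X) : Free.toDual (delta x) = evalFunctional x := rfl

theorem span_range_delta_dense :
    (Submodule.span ℝ (Set.range (delta (X := X)))).topologicalClosure = ⊤ := by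
  have hi : IsInducing (Free.toDual (X := X)) := IsInducing.subtypeVal
  have himg : Free.toDual '' (Submodule.span ℝ (Set.range (delta (X := X))) : Set (Free X)) =
      (Submodule.span ℝ (Set.range (evalFunctional (X := X))) :
        Set (StrongDual ℝ (LipZero X ℝ))) := by
    have := Submodule.map_span (Free.toDual (X := X)).toLinearMap (Set.range (delta (X := X)))
    rw [← Set.range_comp] at this
    exact congrArg SetLike.coe this
  rw [eq_top_iff]
  intro μ _
  change μ ∈ closure (Submodule.span ℝ (Set.range (delta (X := X))) : Set (Free X))
  rw [hi.closure_eq_preimage_closure_image, himg]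
  exact μ.toDual_mem

theorem norm_delta_sub_le (x y : X) : ‖delta x - delta y‖ ≤ 1 * ‖x - y‖ := by
  rw [one_mul]
  rw [← Free.norm_toDual, map_sub, toDual_delta, toDual_delta]
  refine ContinuousLinearMap.opNorm_le_bound _ (norm_nonneg _) fun f => ?_
  simpa [mul_comm] using f.norm_sub_le x y

theorem delta_zero : delta (0 : X) = 0 := by
  apply Free.toDual_injective
  ext f
  simp

variable {Y : Type v} [NormedAddCommGroup Y] [NormedSpace ℝ Y] [CompleteSpace Y]

theorem precomp_transpose_mem_range (f : LipZero X Y) (μ : Free X) :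
    (ContinuousLinearMap.precomp ℝ f.transpose) (Free.toDual μ) ∈
      LinearMap.range (NormedSpace.inclusionInDoubleDualLi ℝ (E := Y)).toLinearMap := by
  set Φ : StrongDual ℝ (LipZero X ℝ) →L[ℝ] StrongDual ℝ (StrongDual ℝ Y) :=
    ContinuousLinearMap.precomp ℝ f.transpose with hΦ
  set R := LinearMap.range (NormedSpace.inclusionInDoubleDualLi ℝ (E := Y)).toLinearMap with hR
  have hclosed : IsClosed (R : Set (StrongDual ℝ (StrongDual ℝ Y))) := by
    have hi := (NormedSpace.inclusionInDoubleDualLi ℝ (E := Y)).isometry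
    exact hi.isUniformInducing.isComplete_range.isClosed
  have hle : freeSpace X ≤ R.comap Φ.toLinearMap := by
    refine Submodule.topologicalClosure_minimal _ ?_ (hclosed.preimage Φ.continuous)
    rw [Submodule.span_le]
    rintro _ ⟨x, rfl⟩
    exact ⟨f x, by ext φ; rfl⟩
  exact hle μ.toDual_mem

/-- The linearization `L_f : 𝔉(X) → Y` of `f ∈ Lip₀(X, Y)`; it is the unique bounded linear
operator with `L_f ∘ δ_X = f`. -/
def linearize (f : LipZero X Y) : Free X →L[ℝ] Y :=
  ((NormedSpace.inclusionInDoubleDualLi ℝ (E := Y)).equivRange.symm :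
      _ →L[ℝ] Y).comp
    (((ContinuousLinearMap.precomp ℝ f.transpose).comp Free.toDual).codRestrict
      (LinearMap.range (NormedSpace.inclusionInDoubleDualLi ℝ (E := Y)).toLinearMap)
      (precomp_transpose_mem_range f))

theorem dual_linearize (f : LipZero X Y) (μ : Free X) (φ : StrongDual ℝ Y) :
    φ (linearize f μ) = (Free.toDual μ) (f.transpose φ) := by
  have h : NormedSpace.inclusionInDoubleDualLi ℝ (linearize f μ) =
      (ContinuousLinearMap.precomp ℝ f.transpose) (Free.toDual μ) := by
    have := (NormedSpace.inclusionInDoubleDualLi ℝ (E := Y)).equivRange.apply_symm_apply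
      ⟨_, precomp_transpose_mem_range f μ⟩
    exact congrArg Subtype.val this
  exact congrArg (fun F : StrongDual ℝ (StrongDual ℝ Y) => F φ) h

theorem linearize_delta (f : LipZero X Y) (x : X) : linearize f (delta x) = f x := by
  refine (SeparatingDual.eq_iff_forall_dual_eq (R := ℝ)).2 ?_
  intro φ
  rw [dual_linearize]
  rfl

theorem linearize_unique (f : LipZero X Y) (T : Free X →L[ℝ] Y) (hT : ∀ x, T (delta x) = f x) :
    T = linearize f := by
  have h : Submodule.span ℝ (Set.range (delta (X := X))) ≤
      LinearMap.ker (T - linearize f).toLinearMap := by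
    rw [Submodule.span_le]
    rintro _ ⟨x, rfl⟩
    simp [hT, linearize_delta]
  have h' := Submodule.topologicalClosure_minimal _ h (T - linearize f).isClosed_ker
  rw [span_range_delta_dense] at h'
  ext μ
  have := h' (Submodule.mem_top (x := μ))
  simpa [sub_eq_zero] using this

variable (X) in
/-- The quotient map `β_X : 𝔉(X) → X`, that is the linearization of the identity. -/
def beta [CompleteSpace X] : Free X →L[ℝ] X := linearize (LipZero.id X)

/-- The defining property of `β_X`: `x* (β_X μ) = ⟨x*, μ⟩`, for `x*` seen in `Lip₀(X)`. -/
theorem dual_beta [CompleteSpace X] (μ : Free X) (φ : StrongDual ℝ X) :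
    φ (beta X μ) = (Free.toDual μ) ((LipZero.id X).transpose φ) :=
  dual_linearize _ _ _

/-- The map `δ_X` restricted to a subspace `M`, as an element of `Lip₀(M, 𝔉(X))`. -/
def deltaRestrict (M : Submodule ℝ X) : LipZero M (Free X) :=
  LipZero.ofBound (fun m => delta (m : X)) delta_zero 1
    (fun x y => norm_delta_sub_le (x : X) (y : X))

/-- The canonical map `𝔉(M) → 𝔉(X)` with `δ_m ↦ δ_m`, for a subspace `M` of `X`. -/
def freeInclusion (M : Submodule ℝ X) : Free M →L[ℝ] Free X := linearize (deltaRestrict M)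

theorem toDual_freeInclusion (M : Submodule ℝ X) (μ : Free M) (g : LipZero X ℝ) (h : LipZero M ℝ)
    (hgh : ∀ m : M, g m = h m) : Free.toDual (freeInclusion M μ) g = Free.toDual μ h := by
  let φ : StrongDual ℝ (Free X) :=
    (NormedSpace.inclusionInDoubleDual ℝ (LipZero X ℝ) g).comp Free.toDual
  have h1 : φ (freeInclusion M μ) = Free.toDual μ ((deltaRestrict M).transpose φ) :=
    dual_linearize _ _ _
  have h2 : (deltaRestrict M).transpose φ = h := by
    ext m
    exact hgh m
  rw [h2] at h1
  exact h1

/-- The canonical map `𝔉(M) → 𝔉(X)` is isometric. -/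
theorem norm_freeInclusion (M : Submodule ℝ X) (μ : Free M) : ‖freeInclusion M μ‖ = ‖μ‖ := by
  apply le_antisymm
  · rw [← Free.norm_toDual]
    refine ContinuousLinearMap.opNorm_le_bound _ (norm_nonneg _) fun g => ?_
    let h : LipZero M ℝ := LipZero.ofBound (fun m => g m) (by simp) ‖g‖
      (fun x y => g.norm_sub_le x y)
    rw [toDual_freeInclusion M μ g h (fun _ => rfl), ← Free.norm_toDual μ]
    refine (ContinuousLinearMap.le_opNorm _ h).trans
      (mul_le_mul_of_nonneg_left ?_ (norm_nonneg _))
    exact h.norm_le_of (norm_nonneg _) (fun x y => g.norm_sub_le x y)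
  · rw [← Free.norm_toDual μ]
    refine ContinuousLinearMap.opNorm_le_bound _ (norm_nonneg _) fun h => ?_
    classical
    let e : X → ℝ := fun x => if hx : x ∈ M then h ⟨x, hx⟩ else 0
    have he : LipschitzOnWith ‖h‖₊ e M := by
      refine LipschitzOnWith.of_dist_le_mul fun x hx y hy => ?_
      have hx' : x ∈ M := hx
      have hy' : y ∈ M := hy
      simp only [e, hx', hy', dif_pos, dist_eq_norm]
      exact h.norm_sub_le ⟨x, hx'⟩ ⟨y, hy'⟩
    obtain ⟨g₀, hg₀, hext⟩ := he.extend_real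
    have hval : ∀ m : M, g₀ m = h m := fun m => by
      rw [← hext m.2]
      simp [e]
    have hb : ∀ x y, ‖g₀ x - g₀ y‖ ≤ ‖h‖ * ‖x - y‖ := fun x y => by
      simpa [dist_eq_norm] using hg₀.dist_le_mul x y
    let g : LipZero X ℝ := LipZero.ofBound g₀ (by simpa using hval 0) ‖h‖ hb
    rw [← toDual_freeInclusion M μ g h hval, ← Free.norm_toDual (freeInclusion M μ)]
    exact (ContinuousLinearMap.le_opNorm _ g).trans
      (mul_le_mul_of_nonneg_left (g.norm_le_of (norm_nonneg _) hb) (norm_nonneg _))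

/-- The subspace `𝔉(M)` of `𝔉(X)`: the image of the canonical isometric embedding. -/
def freeSubspace (M : Submodule ℝ X) : Submodule ℝ (Free X) :=
  LinearMap.range (freeInclusion M).toLinearMap

instance isClosed_freeSubspace (M : Submodule ℝ X) :
    IsClosed (freeSubspace M : Set (Free X)) := by
  have h : Isometry (freeInclusion M) :=
    AddMonoidHomClass.isometry_of_norm (freeInclusion M) (norm_freeInclusion M)
  exact h.isUniformInducing.isComplete_range.isClosed

end Free

/-! ### Operator ideals -/

/-- An operator ideal on the class of real Banach spaces: components `𝒜(X, Y)` that are linear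
subspaces of `ℒ(X, Y)`, contain the rank-one operators `x ↦ φ(x) y` (hence all finite rank
operators), and satisfy `R T S ∈ 𝒜(W, Z)` for `S ∈ ℒ(W, X)`, `T ∈ 𝒜(X, Y)`, `R ∈ ℒ(Y, Z)`. -/
@[ext] structure OperatorIdeal where
  component : ∀ (X Y : Type u) [NormedAddCommGroup X] [NormedSpace ℝ X] [CompleteSpace X]
    [NormedAddCommGroup Y] [NormedSpace ℝ Y] [CompleteSpace Y], Submodule ℝ (X →L[ℝ] Y)
  smulRight_mem : ∀ {X Y : Type u} [NormedAddCommGroup X] [NormedSpace ℝ X] [CompleteSpace X]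
    [NormedAddCommGroup Y] [NormedSpace ℝ Y] [CompleteSpace Y] (φ : StrongDual ℝ X) (y : Y),
    φ.smulRight y ∈ component X Y
  comp_mem : ∀ {W X Y Z : Type u} [NormedAddCommGroup W] [NormedSpace ℝ W] [CompleteSpace W]
    [NormedAddCommGroup X] [NormedSpace ℝ X] [CompleteSpace X]
    [NormedAddCommGroup Y] [NormedSpace ℝ Y] [CompleteSpace Y]
    [NormedAddCommGroup Z] [NormedSpace ℝ Z] [CompleteSpace Z]
    (R : Y →L[ℝ] Z) (T : X →L[ℝ] Y) (S : W →L[ℝ] X),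
    T ∈ component X Y → R.comp (T.comp S) ∈ component W Z

section Adjoint

variable {X : Type u} {Y : Type v} [NormedAddCommGroup X] [NormedSpace ℝ X]
  [NormedAddCommGroup Y] [NormedSpace ℝ Y]

/-- The Banach space adjoint `T* : Y* → X*`, `T* φ = φ ∘ T`. -/
def adj (T : X →L[ℝ] Y) : StrongDual ℝ Y →L[ℝ] StrongDual ℝ X := ContinuousLinearMap.precomp ℝ T

@[simp] theorem adj_apply (T : X →L[ℝ] Y) (φ : StrongDual ℝ Y) (x : X) : adj T φ x = φ (T x) := rfl

end Adjoint

namespace OperatorIdeal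

/-- The dual ideal `𝒜^d`, with components `𝒜^d(X, Y) = {T : T* ∈ 𝒜(Y*, X*)}`. -/
def dual (A : OperatorIdeal.{u}) : OperatorIdeal.{u} where
  component X Y _ _ _ _ _ _ :=
    { carrier := {T | adj T ∈ A.component (StrongDual ℝ Y) (StrongDual ℝ X)}
      zero_mem' := by
        have h : adj (0 : X →L[ℝ] Y) = 0 := by ext; simp
        simp [h]
      add_mem' := by
        intro S T hS hT
        have h : adj (S + T) = adj S + adj T := by ext; simp
        simpa only [Set.mem_ofPred_eq, h] using add_mem hS hT
      smul_mem' := by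
        intro c T hT
        have h : adj (c • T) = c • adj T := by ext; simp
        simpa only [Set.mem_ofPred_eq, h] using Submodule.smul_mem _ c hT }
  smulRight_mem {X Y} _ _ _ _ _ _ φ y := by
    have h : adj (φ.smulRight y) =
        (NormedSpace.inclusionInDoubleDual ℝ Y y).smulRight φ := by
      ext ψ x; simp [mul_comm]
    change adj (φ.smulRight y) ∈ A.component (StrongDual ℝ Y) (StrongDual ℝ X)
    rw [h]
    exact A.smulRight_mem _ _
  comp_mem R T S hT := A.comp_mem (adj S) (adj T) (adj R) hT

/-- `𝒜^λ(X, Y) = {T ∈ 𝒜(X, Y) : ‖T‖ ≤ λ}`. -/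
def bounded (A : OperatorIdeal.{u}) (lam : ℝ) (X Y : Type u)
    [NormedAddCommGroup X] [NormedSpace ℝ X] [CompleteSpace X]
    [NormedAddCommGroup Y] [NormedSpace ℝ Y] [CompleteSpace Y] : Set (X →L[ℝ] Y) :=
  {T | T ∈ A.component X Y ∧ ‖T‖ ≤ lam}

/-- `Lip_𝒜^λ(X, Y) = {f ∈ Lip₀(X, Y) : L_f ∈ 𝒜(𝔉(X), Y), ‖f‖_Lip ≤ λ}`. -/
def lipBounded (A : OperatorIdeal.{u}) (lam : ℝ) (X Y : Type u)
    [NormedAddCommGroup X] [NormedSpace ℝ X]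
    [NormedAddCommGroup Y] [NormedSpace ℝ Y] [CompleteSpace Y] : Set (LipZero X Y) :=
  {f | linearize f ∈ A.component (Free X) Y ∧ ‖f‖ ≤ lam}

end OperatorIdeal

section BAP

variable (A : OperatorIdeal.{u}) (X : Type u) [NormedAddCommGroup X] [NormedSpace ℝ X]
  [CompleteSpace X]

/-- The `𝒜`-bounded approximation property: for some `λ ≥ 1` the identity lies in the closure of
`𝒜^λ(X, X)` for the topology of uniform convergence on compact sets
(the compact-open topology of `C(X, X)`). -/
def HasBAP : Prop :=
  ∃ lam : ℝ, 1 ≤ lam ∧ ContinuousMap.id X ∈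
    closure ((fun T : X →L[ℝ] X => (⟨T, T.continuous⟩ : C(X, X))) '' A.bounded lam X X)

/-- The Lipschitz `𝒜`-bounded approximation property: for some `λ ≥ 1` the identity lies in the
closure of `Lip_𝒜^λ(X, X)` for the topology of uniform convergence on compact sets. -/
def HasLipBAP : Prop :=
  ∃ lam : ℝ, 1 ≤ lam ∧ ContinuousMap.id X ∈
    closure (LipZero.toContinuousMap '' A.lipBounded lam X X)

end BAP

/-! ### Ideals (locally complemented subspaces) -/

/-- `N` is an ideal in `E` (locally complemented): there is a Hahn-Banach extension operator
`N* → E*`. -/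
def IsIdealIn {E : Type u} [NormedAddCommGroup E] [NormedSpace ℝ E] (N : Submodule ℝ E) : Prop :=
  ∃ σ : StrongDual ℝ N →L[ℝ] StrongDual ℝ E,
    ∀ φ : StrongDual ℝ N, (∀ y : N, σ φ (y : E) = φ y) ∧ ‖σ φ‖ = ‖φ‖

/-! ### The weak-star topology on `ℒ(E, F*)` -/

section WeakStar

variable (E F : Type u) [NormedAddCommGroup E] [NormedSpace ℝ E]
  [NormedAddCommGroup F] [NormedSpace ℝ F]

/-- The pair of spaces `E`, `F` as a family over `Bool`. -/
abbrev pair (b : Bool) : Type u := match b with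
  | true => E
  | false => F

instance pairGroup : ∀ b, NormedAddCommGroup (pair E F b)
  | true => inferInstanceAs (NormedAddCommGroup E)
  | false => inferInstanceAs (NormedAddCommGroup F)

instance pairSpace : ∀ b, NormedSpace ℝ (pair E F b)
  | true => inferInstanceAs (NormedSpace ℝ E)
  | false => inferInstanceAs (NormedSpace ℝ F)

/-- The completed projective tensor product of `E` and `F`: the completion of the algebraic
tensor product for the projective (semi)norm. -/
abbrev ProjTensor : Type u := UniformSpace.Completion (⨂[ℝ] b, pair E F b)

variable {E F}

/-- The pair `(x, y)` as an element of the product of the family. -/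
def pairVec (x : E) (y : F) : ∀ b, pair E F b
  | true => x
  | false => y

/-- The elementary tensor `x ⊗ y`. -/
def tmul (x : E) (y : F) : ProjTensor E F :=
  ((PiTensorProduct.tprod ℝ (pairVec x y) : ⨂[ℝ] b, pair E F b) : ProjTensor E F)

/-- The bounded bilinear form `(x, y) ↦ (T x) y` on `E × F` given by `T ∈ ℒ(E, F*)`. -/
def bilinForm (T : E →L[ℝ] StrongDual ℝ F) :
    ContinuousMultilinearMap ℝ (pair E F) ℝ :=
  MultilinearMap.mkContinuous
    { toFun := fun m => T (m true) (m false)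
      map_update_add' := by
        intro _ m i a b
        cases i <;> simp
      map_update_smul' := by
        intro _ m i c a
        cases i <;> simp }
    ‖T‖ (fun m => by
      simpa [mul_assoc] using! T.le_opNorm₂ (m true) (m false))

/-- The functional on the completed projective tensor product given by `T ∈ ℒ(E, F*)`:
the continuous linear extension of `x ⊗ y ↦ (T x) y`. -/
def tensorPairing (T : E →L[ℝ] StrongDual ℝ F) : StrongDual ℝ (ProjTensor E F) :=
  (PiTensorProduct.liftIsometry ℝ (pair E F) ℝ (bilinForm T)).extend
    (UniformSpace.Completion.toComplL (𝕜 := ℝ))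

theorem tensorPairing_coe (T : E →L[ℝ] StrongDual ℝ F) (u : ⨂[ℝ] b, pair E F b) :
    tensorPairing T (u : ProjTensor E F) =
      PiTensorProduct.lift (bilinForm T).toMultilinearMap u := by
  rw [← PiTensorProduct.liftIsometry_apply_apply]
  exact ContinuousLinearMap.extend_eq _ UniformSpace.Completion.denseRange_coe
    (UniformSpace.Completion.isUniformInducing_coe _) u

theorem tensorPairing_tmul (T : E →L[ℝ] StrongDual ℝ F) (x : E) (y : F) :
    tensorPairing T (tmul x y) = T x y := by
  rw [tmul, tensorPairing_coe]
  simp [bilinForm, pairVec]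

variable (E F) in
/-- The weak-star topology on `ℒ(E, F*)`, identified with the dual of the completed projective
tensor product of `E` and `F`: the coarsest topology for which all the functionals `T ↦ ⟨T, u⟩`
are continuous. -/
abbrev weakStarTopology : TopologicalSpace (E →L[ℝ] StrongDual ℝ F) :=
  TopologicalSpace.induced (fun T (u : ProjTensor E F) => tensorPairing T u) Pi.topologicalSpace

end WeakStar

end LipFreeAP

end

open LipFreeAP

open Filter

namespace LipFreeAP

/-! Write `Q` for the quotient of `𝔉(X)` by `𝔉(M)`, `π` for the quotient map, `j : X* → M*` for
restriction and `σ'` for the extension operator `𝔉(M)* → 𝔉(X)*` given by the ideal property. For `f`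
in the Lipschitz approximating net of `M`, the operator `σ' ∘ L_f* ∘ j` lies in the ideal, because
`L_f` does and adjoints stay in a self-dual ideal. By compactness this bounded net has a pointwise
limit `R`. Since `L_f → β_M` pointwise, `R φ` and `β_X* φ` agree on `𝔉(M)` for every `φ`.

So `β_X* - R` takes values in the annihilator of `𝔉(M)`, which is `Q*`, and factors as `π* ∘ S`. If
`T` runs through the approximating net of `Q`, then `π* ∘ T* ∘ S` lies in the ideal and tends to `π*
∘ S`. The sums `σ' ∘ L_f* ∘ j + π* ∘ T* ∘ S` are bounded, lie in the ideal and converge pointwise to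
`β_X*`; `R` itself need not belong to the ideal. The second half is
`mem_weakStar_closure_of_quotient`. Boundedness turns pointwise into weak-star convergence in
`mem_weakStar_closure`. -/

/-! ### Limits of bounded nets -/

/-- Bounded nets of operators converging on a total set converge pointwise. -/
theorem tendsto_apply_of_span_dense {E F ι : Type*} [NormedAddCommGroup E] [NormedSpace ℝ E]
    [NormedAddCommGroup F] [NormedSpace ℝ F] {l : Filter ι} {T : ι → E →L[ℝ] F}
    {T₀ : E →L[ℝ] F} {C : ℝ} (hT : ∀ᶠ i in l, ‖T i‖ ≤ C) {s : Set E}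
    (hs : Dense (Submodule.span ℝ s : Set E))
    (h : ∀ x ∈ s, Tendsto (fun i => T i x) l (𝓝 (T₀ x))) (x : E) :
    Tendsto (fun i => T i x) l (𝓝 (T₀ x)) := by
  have hspan : ∀ y ∈ Submodule.span ℝ s, Tendsto (fun i => T i y) l (𝓝 (T₀ y)) := by
    intro y hy
    induction hy using Submodule.span_induction with
    | mem y hy => exact h y hy
    | zero => simpa using tendsto_const_nhds
    | add y z _ _ hy hz => simpa using hy.add hz
    | smul c y _ hy => simpa using hy.const_smul c
  -- The absolute value is there because `C` is not assumed nonnegative; the summand 1 makes `K`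
  -- positive, so that `ε / (2 * K)` is a legitimate radius.
  set K : ℝ := |C| + ‖T₀‖ + 1 with hK
  have hK0 : 0 < K := by positivity
  rw [Metric.tendsto_nhds]
  intro ε hε
  obtain ⟨y, hy, hxy⟩ := Metric.dense_iff.1 hs x (ε / (2 * K)) (by positivity)
  have hyx : ‖x - y‖ < ε / (2 * K) := by
    rw [← dist_eq_norm, dist_comm]
    exact hy
  have hKe : K * (ε / (2 * K)) = ε / 2 := by field_simp
  filter_upwards [hT, Metric.tendsto_nhds.1 (hspan y hxy) (ε / 2) (by positivity)] with i hi hiy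
  rw [dist_eq_norm] at hiy ⊢
  have hdec : T i x - T₀ x = T i (x - y) - T₀ (x - y) + (T i y - T₀ y) := by
    simp only [map_sub]
    abel
  have h1 : ‖T i (x - y)‖ ≤ |C| * ‖x - y‖ :=
    (T i).le_of_opNorm_le (hi.trans (le_abs_self C)) _
  have h2 : ‖T₀ (x - y)‖ ≤ ‖T₀‖ * ‖x - y‖ := T₀.le_opNorm _
  have h3 : (|C| + ‖T₀‖) * ‖x - y‖ ≤ K * (ε / (2 * K)) := by
    gcongr
    linarith
  rw [hdec]
  calc _ ≤ ‖T i (x - y)‖ + ‖T₀ (x - y)‖ + ‖T i y - T₀ y‖ :=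
        (norm_add_le _ _).trans (add_le_add_left (norm_sub_le _ _) _)
    _ < ε := by linarith

/-- A bounded net of bilinear forms has a limit along every ultrafilter. -/
theorem exists_tendsto_of_ultrafilter {E F ι : Type*} [NormedAddCommGroup E] [NormedSpace ℝ E]
    [NormedAddCommGroup F] [NormedSpace ℝ F] (U : Ultrafilter ι)
    {T : ι → E →L[ℝ] StrongDual ℝ F} {C : ℝ} (hT : ∀ᶠ i in (U : Filter ι), ‖T i‖ ≤ C) :
    ∃ R : E →L[ℝ] StrongDual ℝ F, ∀ x y, Tendsto (fun i => T i x y) U (𝓝 (R x y)) := by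
  have hb : ∀ x y, ∀ᶠ i in (U : Filter ι), ‖T i x y‖ ≤ C * ‖x‖ * ‖y‖ := fun x y => by
    filter_upwards [hT] with i hi
    exact (T i).le_of_opNorm₂_le_of_le hi le_rfl le_rfl
  have hlim : ∀ x y, ∃ r : ℝ, Tendsto (fun i => T i x y) U (𝓝 r) := fun x y => by
    -- For fixed `x` and `y` the values stay in a compact interval, so the image ultrafilter
    -- converges.
    obtain ⟨r, -, hr⟩ := (isCompact_closedBall (0 : ℝ) (C * ‖x‖ * ‖y‖)).ultrafilter_le_nhds
      (U.map fun i => T i x y) (le_principal_iff.2 (by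
        change ∀ᶠ i in (U : Filter ι), T i x y ∈ _
        filter_upwards [hb x y] with i hi
        simpa using hi))
    exact ⟨r, hr⟩
  choose r hr using hlim
  have hbound : ∀ x y, ‖r x y‖ ≤ C * ‖x‖ * ‖y‖ := fun x y =>
    le_of_tendsto (hr x y).norm (hb x y)
  -- Bilinearity is inherited from the `T i` by uniqueness of limits.
  let L : E →ₗ[ℝ] F →ₗ[ℝ] ℝ := LinearMap.mk₂ ℝ r
    (fun x x' y => tendsto_nhds_unique (hr _ y) (by simpa using (hr x y).add (hr x' y)))
    (fun c x y => tendsto_nhds_unique (hr _ y) (by simpa using (hr x y).const_mul c))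
    (fun x y y' => tendsto_nhds_unique (hr x _) (by simpa using (hr x y).add (hr x y')))
    (fun c x y => tendsto_nhds_unique (hr x _) (by simpa using (hr x y).const_mul c))
  exact ⟨L.mkContinuous₂ C hbound, hr⟩

/-- An element of the closure of an image is a limit of images along a filter. -/
theorem exists_filter_of_mem_closure_image {α β : Type*} [TopologicalSpace β] {f : α → β}
    {s : Set α} {b : β} (h : b ∈ closure (f '' s)) :
    ∃ U : Ultrafilter α, (∀ᶠ a in (U : Filter α), a ∈ s) ∧ Tendsto f U (𝓝 b) := by
  have hne : (𝓝[f '' s] b).NeBot := mem_closure_iff_nhdsWithin_neBot.1 h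
  have : NeBot (comap f (𝓝[f '' s] b) ⊓ 𝓟 s) :=
    comap_inf_principal_neBot_of_image_mem hne self_mem_nhdsWithin
  obtain ⟨U, hU⟩ := Ultrafilter.exists_le (comap f (𝓝[f '' s] b) ⊓ 𝓟 s)
  exact ⟨U, le_principal_iff.1 (hU.trans inf_le_right),
    (tendsto_comap.mono_left (hU.trans inf_le_left)).mono_right nhdsWithin_le_nhds⟩

/-! ### Weak-star topology and elementary tensors -/

section WeakStar

variable {E F : Type u} [NormedAddCommGroup E] [NormedSpace ℝ E]
  [NormedAddCommGroup F] [NormedSpace ℝ F]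

theorem norm_bilinForm_le (T : E →L[ℝ] StrongDual ℝ F) : ‖bilinForm T‖ ≤ ‖T‖ :=
  MultilinearMap.mkContinuous_norm_le _ (norm_nonneg T) _

theorem norm_tensorPairing_le (T : E →L[ℝ] StrongDual ℝ F) : ‖tensorPairing T‖ ≤ ‖T‖ := by
  refine ContinuousLinearMap.opNorm_le_bound _ (norm_nonneg T) fun z => ?_
  induction z using UniformSpace.Completion.induction_on with
  | hp => exact isClosed_le (by fun_prop) (by fun_prop)
  | ih u =>
    rw [tensorPairing_coe, ← PiTensorProduct.liftIsometry_apply_apply,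
      UniformSpace.Completion.norm_coe]
    refine ContinuousLinearMap.le_of_opNorm_le _ ?_ u
    rw [LinearIsometryEquiv.norm_map]
    exact norm_bilinForm_le T

/-- Elementary tensors span the algebraic tensor product, which is dense in its completion. This
reduces weak-star convergence of bounded nets to pointwise convergence. -/
theorem dense_span_range_tmul :
    Dense (Submodule.span ℝ (Set.range fun p : E × F => tmul p.1 p.2) :
      Set (ProjTensor E F)) := by
  refine UniformSpace.Completion.denseRange_coe.mono ?_
  rintro _ ⟨u, rfl⟩
  have hu : u ∈ Submodule.span ℝ (Set.range (PiTensorProduct.tprod ℝ (s := pair E F))) := by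
    rw [PiTensorProduct.span_tprod_eq_top]
    trivial
  induction hu using Submodule.span_induction with
  | mem u hu =>
    obtain ⟨m, rfl⟩ := hu
    refine Submodule.subset_span ⟨(m true, m false), ?_⟩
    have : pairVec (m true) (m false) = m := by
      ext b
      cases b <;> rfl
    simp only [tmul, this]
  | zero => exact zero_mem _
  | add u v _ _ hu hv =>
    rw [UniformSpace.Completion.coe_add]
    exact add_mem hu hv
  | smul c u _ hu =>
    rw [UniformSpace.Completion.coe_smul]
    exact Submodule.smul_mem _ c hu

/-- Bounded pointwise limits belong to the weak-star closure. -/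
theorem mem_weakStar_closure {ι : Type*} {l : Filter ι} [NeBot l]
    {T : ι → E →L[ℝ] StrongDual ℝ F} {R : E →L[ℝ] StrongDual ℝ F}
    {S : Set (E →L[ℝ] StrongDual ℝ F)} {C : ℝ} (hC : ∀ᶠ i in l, ‖T i‖ ≤ C)
    (hS : ∀ᶠ i in l, T i ∈ S) (h : ∀ x y, Tendsto (fun i => T i x y) l (𝓝 (R x y))) :
    R ∈ closure[weakStarTopology E F] S := by
  let := weakStarTopology E F
  refine mem_closure_of_tendsto (f := T) (b := l) ?_ hS
  rw [nhds_induced, tendsto_comap_iff, tendsto_pi_nhds]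
  -- The operators are viewed as bounded functionals on the projective tensor product, with
  -- elementary tensors as the total set.
  refine tendsto_apply_of_span_dense (T := fun i => tensorPairing (T i)) (C := C) ?_
    dense_span_range_tmul ?_
  · filter_upwards [hC] with i hi using (norm_tensorPairing_le _).trans hi
  · rintro _ ⟨⟨x, y⟩, rfl⟩
    simpa only [tensorPairing_tmul] using h x y

end WeakStar

/-! ### Factorization through a quotient, adjoints and linearizations -/

/-- An operator into `E*` whose values vanish on the kernel of a quotient map `π : E → Q` factors
through `π* : Q* → E*`. -/
theorem exists_factor_adj {V E Q : Type*} [NormedAddCommGroup V] [NormedSpace ℝ V]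
    [NormedAddCommGroup E] [NormedSpace ℝ E] [NormedAddCommGroup Q] [NormedSpace ℝ Q]
    (π : E →L[ℝ] Q) (hπ : ∀ z, ∀ ε > 0, ∃ y, π y = z ∧ ‖y‖ < ‖z‖ + ε)
    (D : V →L[ℝ] StrongDual ℝ E) (hD : ∀ v y, π y = 0 → D v y = 0) :
    ∃ S : V →L[ℝ] StrongDual ℝ Q, ∀ v y, S v (π y) = D v y := by
  -- `s` is an arbitrary section of `π`, neither linear nor continuous. Linearity in `z` holds
  -- because each `D v` is constant on the fibres of `π`.
  choose s hs _ using fun z => hπ z 1 one_pos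
  have hDπ : ∀ v y y', π y = π y' → D v y = D v y' := fun v y y' h => by
    rw [← sub_eq_zero, ← map_sub]
    exact hD v _ (by rw [map_sub, h, sub_self])
  let L : V →ₗ[ℝ] Q →ₗ[ℝ] ℝ := LinearMap.mk₂ ℝ (fun v z => D v (s z))
    (fun v w z => by simp)
    (fun c v z => by simp)
    (fun v z z' => by
      rw [← map_add]
      exact hDπ v _ _ (by simp [hs]))
    (fun c v z => by
      rw [← map_smul]
      exact hDπ v _ _ (by simp [hs]))
  have hL : ∀ v z, ‖L v z‖ ≤ ‖D‖ * ‖v‖ * ‖z‖ := by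
    intro v z
    refine le_of_forall_pos_le_add fun ε hε => ?_
    have hpos : 0 < ‖D‖ * ‖v‖ + 1 := by positivity
    -- The section `s` gives no sharp bound, so a nearly norm-minimal lift is used; the excess is
    -- scaled to contribute at most `ε` after multiplication by `‖D‖ * ‖v‖`.
    obtain ⟨y, hyz, hy⟩ := hπ z (ε / (‖D‖ * ‖v‖ + 1)) (div_pos hε hpos)
    calc ‖L v z‖ = ‖D v y‖ := congrArg norm (hDπ v _ _ (by rw [hs, hyz]))
      _ ≤ ‖D‖ * ‖v‖ * ‖y‖ := D.le_opNorm₂ v y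
      _ ≤ ‖D‖ * ‖v‖ * (‖z‖ + ε / (‖D‖ * ‖v‖ + 1)) := by gcongr
      _ ≤ _ := by
        rw [mul_add]
        gcongr
        rw [mul_div_assoc', div_le_iff₀ hpos]
        nlinarith
  exact ⟨L.mkContinuous₂ _ hL, fun v y => hDπ v _ _ (hs _)⟩

theorem norm_adj_le {E F : Type*} [NormedAddCommGroup E] [NormedSpace ℝ E]
    [NormedAddCommGroup F] [NormedSpace ℝ F] (T : E →L[ℝ] F) : ‖adj T‖ ≤ ‖T‖ :=
  ContinuousLinearMap.opNorm_le_bound _ (norm_nonneg _) fun φ => by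
    rw [mul_comm]
    exact ContinuousLinearMap.opNorm_comp_le φ T

/-- By duality: testing `L_f μ` against `φ` amounts to evaluating `μ` at `φ ∘ f`, whose Lipschitz
norm is at most `‖φ‖ * ‖f‖`. -/
theorem norm_linearize_le {X Y : Type*} [NormedAddCommGroup X] [NormedSpace ℝ X]
    [NormedAddCommGroup Y] [NormedSpace ℝ Y] [CompleteSpace Y] (f : LipZero X Y) :
    ‖linearize f‖ ≤ ‖f‖ := by
  refine ContinuousLinearMap.opNorm_le_bound _ (norm_nonneg _) fun μ => ?_
  refine NormedSpace.norm_le_dual_bound ℝ _ (by positivity) fun φ => ?_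
  rw [dual_linearize]
  have hf : ‖f.transpose φ‖ ≤ ‖φ‖ * ‖f‖ :=
    LipZero.norm_le_of _ (by positivity) fun x y => by
      rw [LipZero.transpose_apply, LipZero.transpose_apply, ← map_sub, mul_assoc]
      exact (φ.le_opNorm _).trans
        (mul_le_mul_of_nonneg_left (f.norm_sub_le x y) (norm_nonneg φ))
  calc _ ≤ ‖μ‖ * (‖φ‖ * ‖f‖) := (Free.toDual μ).le_of_opNorm_le_of_le le_rfl hf
    _ = _ := by ring

/-! ### Self-dual ideals and approximating nets -/

theorem OperatorIdeal.adj_mem {A : OperatorIdeal.{u}} (hA : A = A.dual) {X Y : Type u}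
    [NormedAddCommGroup X] [NormedSpace ℝ X] [CompleteSpace X]
    [NormedAddCommGroup Y] [NormedSpace ℝ Y] [CompleteSpace Y] {T : X →L[ℝ] Y}
    (hT : T ∈ A.component X Y) : adj T ∈ A.component (StrongDual ℝ Y) (StrongDual ℝ X) := by
  have h : T ∈ A.dual.component X Y := hA ▸ hT
  exact h

theorem HasBAP.exists_ultrafilter {A : OperatorIdeal.{u}} {X : Type u} [NormedAddCommGroup X]
    [NormedSpace ℝ X] [CompleteSpace X] (h : HasBAP A X) :
    ∃ (lam : ℝ) (U : Ultrafilter (X →L[ℝ] X)), 1 ≤ lam ∧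
      (∀ᶠ T in (U : Filter (X →L[ℝ] X)), T ∈ A.bounded lam X X) ∧
      ∀ x, Tendsto (fun T : X →L[ℝ] X => T x) U (𝓝 x) := by
  obtain ⟨lam, hlam, hcl⟩ := h
  obtain ⟨U, hU, hlim⟩ := exists_filter_of_mem_closure_image hcl
  exact ⟨lam, U, hlam, hU, fun x => ((continuous_eval_const x).tendsto _).comp hlim⟩

/-- On `δ_x` the linearization of `f` takes the value `f x`, which tends to `x = β_X δ_x`. The bound
on the Lipschitz norms and the density of the span of the `δ_x` carry this to all of `𝔉(X)`. -/
theorem HasLipBAP.exists_ultrafilter {A : OperatorIdeal.{u}} {X : Type u} [NormedAddCommGroup X]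
    [NormedSpace ℝ X] [CompleteSpace X] (h : HasLipBAP A X) :
    ∃ (lam : ℝ) (U : Ultrafilter (LipZero X X)), 1 ≤ lam ∧
      (∀ᶠ f in (U : Filter (LipZero X X)), f ∈ A.lipBounded lam X X) ∧
      ∀ μ, Tendsto (fun f : LipZero X X => linearize f μ) U (𝓝 (beta X μ)) := by
  obtain ⟨lam, hlam, hcl⟩ := h
  obtain ⟨U, hU, hlim⟩ := exists_filter_of_mem_closure_image hcl
  refine ⟨lam, U, hlam, hU, tendsto_apply_of_span_dense (C := lam) ?_
    (Submodule.dense_iff_topologicalClosure_eq_top.2 span_range_delta_dense) ?_⟩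
  · filter_upwards [hU] with f hf using (norm_linearize_le f).trans hf.2
  · rintro _ ⟨x, rfl⟩
    simp only [beta, linearize_delta]
    exact ((continuous_eval_const (F := C(X, X)) x).tendsto _).comp hlim

/-- Both sides linearize the inclusion of `M` into `X`, so uniqueness of linearizations applies. -/
theorem beta_freeInclusion {X : Type u} [NormedAddCommGroup X] [NormedSpace ℝ X]
    [CompleteSpace X] (M : Submodule ℝ X) [CompleteSpace M] (μ : Free M) :
    beta X (freeInclusion M μ) = beta M μ := by
  have h : ((beta X).comp (freeInclusion M)) =
      M.subtypeL.comp (beta M) := by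
    let g : LipZero M X := LipZero.ofBound (fun m => (m : X)) rfl 1 (by simp)
    rw [linearize_unique g ((beta X).comp (freeInclusion M)) fun x => ?_,
      linearize_unique g (M.subtypeL.comp (beta M)) fun x => ?_]
    · simp [beta, linearize_delta, g]
    · have h : freeInclusion M (delta x) = delta (x : X) := linearize_delta _ _
      simp [beta, h, linearize_delta, g]
  exact congrArg (fun T => T μ) h

/-! ### Correction by the approximation property of the quotient -/

/-- An operator `B : V → E*` that differs from a bounded pointwise limit `R` of operators in the
ideal by an operator vanishing on the kernel of a quotient map `E → Q` is itself in the weak-star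
closure of a bounded part of the ideal, if `Q` has the bounded approximation property. -/
theorem mem_weakStar_closure_of_quotient {A : OperatorIdeal.{u}} (hA : A = A.dual)
    {V E Q : Type u}
    [NormedAddCommGroup V] [NormedSpace ℝ V] [CompleteSpace V]
    [NormedAddCommGroup E] [NormedSpace ℝ E] [CompleteSpace E]
    [NormedAddCommGroup Q] [NormedSpace ℝ Q] [CompleteSpace Q]
    (π : E →L[ℝ] Q) (hπ : ∀ z, ∀ ε > 0, ∃ y, π y = z ∧ ‖y‖ < ‖z‖ + ε) (hQ : HasBAP A Q)
    {ι : Type*} {l : Filter ι} [NeBot l] {G : ι → V →L[ℝ] StrongDual ℝ E} {C : ℝ}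
    (hG : ∀ᶠ i in l, G i ∈ A.bounded C V (StrongDual ℝ E))
    {B R : V →L[ℝ] StrongDual ℝ E}
    (hR : ∀ x y, Tendsto (fun i => G i x y) l (𝓝 (R x y)))
    (hBR : ∀ x y, π y = 0 → B x y = R x y) :
    ∃ lam : ℝ, 1 ≤ lam ∧ B ∈ closure[weakStarTopology V E] (A.bounded lam V (StrongDual ℝ E)) := by
  obtain ⟨b, U, -, hU, hUlim⟩ := hQ.exists_ultrafilter
  obtain ⟨S, hS⟩ := exists_factor_adj π hπ (B - R) fun x y h => by simp [hBR x y h]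
  -- `S` satisfies `B - R = π* ∘ S`; inserting `T*` puts the correction into the ideal.
  let H : (Q →L[ℝ] Q) → V →L[ℝ] StrongDual ℝ E := fun T => (adj π).comp ((adj T).comp S)
  have hH : ∀ᶠ T in (U : Filter (Q →L[ℝ] Q)), ‖H T‖ ≤ ‖adj π‖ * (b * ‖S‖) := by
    filter_upwards [hU] with T hT
    refine (ContinuousLinearMap.opNorm_comp_le _ _).trans
      (mul_le_mul_of_nonneg_left ?_ (norm_nonneg _))
    exact (ContinuousLinearMap.opNorm_comp_le _ _).trans
      (mul_le_mul_of_nonneg_right ((norm_adj_le _).trans hT.2) (norm_nonneg _))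
  -- The two nets are independent, so the sums are indexed by the product filter. The maximum with 1
  -- secures `1 ≤ lam`.
  have hbound : ∀ᶠ p in l ×ˢ (U : Filter (Q →L[ℝ] Q)),
      ‖G p.1 + H p.2‖ ≤ max 1 (C + ‖adj π‖ * (b * ‖S‖)) := by
    filter_upwards [hG.prod_mk hH] with p hp
    exact (norm_add_le _ _).trans ((add_le_add hp.1.2 hp.2).trans (le_max_right _ _))
  refine ⟨max 1 (C + ‖adj π‖ * (b * ‖S‖)), le_max_left _ _, mem_weakStar_closure hbound ?_ ?_⟩
  · filter_upwards [hbound, hG.prod_mk hU] with p hp hGU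
    exact ⟨add_mem hGU.1.1 (A.comp_mem (adj π) _ S (A.adj_mem hA hGU.2.1)), hp⟩
  · intro x y
    have hsum : B x y = R x y + S x (π y) := by simp [hS]
    rw [hsum]
    exact ((hR x y).comp tendsto_fst).add
      ((((S x).continuous.tendsto _).comp (hUlim _)).comp tendsto_snd)

end LipFreeAP

/-! ### Approximation of the adjoint of `β_X` -/

theorem mainTheorem9 {X : Type u} [NormedAddCommGroup X] [NormedSpace ℝ X] [CompleteSpace X]
    (M : Submodule ℝ X) [CompleteSpace M]
    (hideal : IsIdealIn (freeSubspace M))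
    (A : OperatorIdeal.{u}) (hA : A = A.dual)
    (hM : HasLipBAP A M)
    (hQ : HasBAP A (Free X ⧸ freeSubspace M)) :
    ∃ lam : ℝ, 1 ≤ lam ∧
      adj (beta X) ∈ closure[weakStarTopology (StrongDual ℝ X) (Free X)]
        (A.bounded lam (StrongDual ℝ X) (StrongDual ℝ (Free X))) := by
  obtain ⟨σ, hσ⟩ := hideal
  obtain ⟨a, U, -, hU, hUlim⟩ := hM.exists_ultrafilter
  let ι : Free M →ₗᵢ[ℝ] Free X :=
    { toLinearMap := (freeInclusion M).toLinearMap, norm_map' := norm_freeInclusion M }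
  -- The ideal property concerns the range of the embedding; its inverse `e` transports `σ` to an
  -- operator on `𝔉(M)*`.
  let e : freeSubspace M →L[ℝ] Free M :=
    (ι.equivRange.symm.toContinuousLinearEquiv : ι.range →L[ℝ] Free M)
  have he : ∀ μ (h : freeInclusion M μ ∈ freeSubspace M), e ⟨freeInclusion M μ, h⟩ = μ :=
    fun μ _ => ι.equivRange.symm_apply_apply μ
  let σ' := σ.comp (adj e)
  let j := adj M.subtypeL
  let G : LipZero M M → StrongDual ℝ X →L[ℝ] StrongDual ℝ (Free X) :=
    fun f => σ'.comp ((adj (linearize f)).comp j)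
  -- On `𝔉(M)` the operator `σ` merely extends, so only `L_f` remains visible there.
  have hG : ∀ f φ μ, G f φ (freeInclusion M μ) = φ (linearize f μ : M) := by
    intro f φ μ
    have hμ : freeInclusion M μ ∈ freeSubspace M := ⟨μ, rfl⟩
    refine ((hσ (adj e (adj (linearize f) (j φ)))).1 ⟨freeInclusion M μ, hμ⟩).trans ?_
    rw [adj_apply, he]
    rfl
  have hGb : ∀ᶠ f in (U : Filter (LipZero M M)), G f ∈
      A.bounded (‖σ'‖ * (a * ‖j‖)) (StrongDual ℝ X) (StrongDual ℝ (Free X)) := by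
    filter_upwards [hU] with f hf
    refine ⟨A.comp_mem σ' _ j (A.adj_mem hA hf.1), ?_⟩
    refine (ContinuousLinearMap.opNorm_comp_le _ _).trans
      (mul_le_mul_of_nonneg_left ?_ (norm_nonneg _))
    exact (ContinuousLinearMap.opNorm_comp_le _ _).trans (mul_le_mul_of_nonneg_right
      ((norm_adj_le _).trans ((norm_linearize_le f).trans hf.2)) (norm_nonneg _))
  obtain ⟨R, hR⟩ := exists_tendsto_of_ultrafilter U (hGb.mono fun _ h => h.2)
  let π : Free X →L[ℝ] Free X ⧸ freeSubspace M :=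
    (freeSubspace M).mkQ.mkContinuous 1 fun y => by
      rw [one_mul]
      exact Submodule.Quotient.norm_mk_le (freeSubspace M) y
  refine mem_weakStar_closure_of_quotient hA π
    (fun _ _ hε => Submodule.Quotient.norm_mk_lt _ hε) hQ hGb hR fun φ y hy => ?_
  -- The kernel of `π` is `𝔉(M)`, where the limit defining `R φ` can be computed: it is `φ (β_M μ)`.
  obtain ⟨μ, rfl⟩ : y ∈ freeSubspace M := (Submodule.Quotient.mk_eq_zero _).1 hy
  have h1 := hR φ (freeInclusion M μ)
  simp only [hG] at h1
  have h2 : Tendsto (fun f : LipZero M M => φ (linearize f μ : M)) U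
      (𝓝 (φ (beta M μ : M))) :=
    ((φ.continuous.comp continuous_subtype_val).tendsto _).comp (hUlim μ)
  change φ (beta X (freeInclusion M μ)) = R φ (freeInclusion M μ)
  rw [tendsto_nhds_unique h1 h2, beta_freeInclusion]
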